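/- Let $H$ be a complex Hilbert space with an orthonormal basis $(e_i)_{i\in I}$. An operator $A\in\mathcal B(H)$ is Hilbert–Schmidt if $\sum_{i\in I}\|Ae_i\|^2<\infty$; it is trace class if $\sum_{i\in I}\langle |A|e_i,e_i\rangle<\infty$, where $|A|=(A^*A)^{1/2}$, and then $\operatorname{tr}(A)=\sum_{i\in I}\langle Ae_i,e_i\rangle$. (None of these notions depends on the choice of the basis.) Let $0<R\le\infty$, let $(\alpha_n)_{n\ge 0}$ be complex numbers such that the power series $f(\lambda)=\sum_{n=0}^\infty\alpha_n\lambda^n$ converges for every $\lambda\in\mathbb C$ with $|\lambda|<R$, and put $f_a(\lambda)=\sum_{n=0}^\infty|\alpha_n|\lambda^n$. Assume that $H$ is finite-dimensional or that $\alpha_0=0$. Let $A,B\in\mathcal B(H)$ be normal Hilbert–Schmidt operators with $A^*B=BA^*$, $\operatorname{tr}(|A|^2)<R$ and $\operatorname{tr}(|B|^2)<R$. Then the series $$f(A^*B)=\sum_{n=0}^\infty\alpha_n(A^*B)^n,\qquad f_a(|A|^2)=\sum_{n=0}^\infty|\alpha_n|\,|A|^{2n},\qquad f_a(|B|^2)=\sum_{n=0}^\infty|\alpha_n|\,|B|^{2n}$$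 converge in operator norm, their sums are trace class, and $$\left|\operatorname{tr}\big(f(A^*B)\big)\right|^2\le\operatorname{tr}\big(f_a(|A|^2)\big)\,\operatorname{tr}\big(f_a(|B|^2)\big).$$ -/

import Mathlib

open scoped ComplexOrder

namespace HilbertTrace

variable {ι H : Type*} [NormedAddCommGroup H] [InnerProductSpace ℂ H]

/-- `A` is a Hilbert-Schmidt operator: `∑ i, ‖A e i‖ ^ 2 < ∞`, where `e` is an orthonormal basis of
the Hilbert space `H`, of arbitrary cardinality. -/
def IsHilbertSchmidt (e : HilbertBasis ι ℂ H) (A : H →L[ℂ] H) : Prop :=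
  Summable fun i => ‖A (e i)‖ ^ 2

/-- `A` is a trace class operator: `∑ i, ⟨|A| e i, e i⟩ < ∞`, where `|A| = (A* A) ^ (1/2)` is
the modulus of `A`. (Mathlib's inner product is linear in its second argument, and all terms
are nonnegative real numbers.) -/
def IsTraceClass [CompleteSpace H] (e : HilbertBasis ι ℂ H) (A : H →L[ℂ] H) : Prop :=
  Summable fun i => inner ℂ (e i) (CFC.abs A (e i))

/-- The trace `∑ i, ⟨A e i, e i⟩`; meaningful for trace class operators `A`. -/
noncomputable def trace (e : HilbertBasis ι ℂ H) (A : H →L[ℂ] H) : ℂ :=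
  ∑' i, inner ℂ (e i) (A (e i))

/-- The operator power series `∑ n, a n • T ^ n`, summed in the operator norm; meaningful when
the series converges. -/
noncomputable def opSeries (a : ℕ → ℂ) (T : H →L[ℂ] H) : H →L[ℂ] H :=
  ∑' n, a n • T ^ n

end HilbertTrace

open ContinuousLinearMap

/-! Since A* commutes with B, ⟨e_i, (A*B)^n e_i⟩ = ⟨A^n e_i, B^n e_i⟩; by normality the same holds
for A*A and B*B. So all three traces are double series over (i, n), and the inequality is
Cauchy-Schwarz there with weights |α_n|. The double series converge because ‖A‖² ≤ tr |A|² < R,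
while one factor A in A^n is kept to sum over i; only n = 0 has no such factor, hence the
alternative in the hypothesis. A positive operator is its own modulus, which settles f_a. For f(A*B)
with α_0 = 0, a factor A*B splits off, leaving a product of two Hilbert-Schmidt operators. -/

namespace HilbertTrace

/-- The Cauchy-Schwarz inequality for square-summable families of nonnegative reals. -/
theorem summable_mul_and_tsum_mul_sq_le {κ : Type*} {f g : κ → ℝ} (hf : ∀ k, 0 ≤ f k)
    (hg : ∀ k, 0 ≤ g k) (hf2 : Summable fun k => f k ^ 2) (hg2 : Summable fun k => g k ^ 2) :
    (Summable fun k => f k * g k) ∧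
      (∑' k, f k * g k) ^ 2 ≤ (∑' k, f k ^ 2) * ∑' k, g k ^ 2 := by
  have h := Real.summable_and_inner_le_Lp_mul_Lq_tsum_of_nonneg
    Real.HolderConjugate.two_two hf hg (by simpa using hf2) (by simpa using hg2)
  refine ⟨h.1, ?_⟩
  have hF : 0 ≤ ∑' k, f k ^ 2 := tsum_nonneg fun k => sq_nonneg _
  have hG : 0 ≤ ∑' k, g k ^ 2 := tsum_nonneg fun k => sq_nonneg _
  have h2 := h.2
  simp only [Real.rpow_two, ← Real.sqrt_eq_rpow] at h2
  calc (∑' k, f k * g k) ^ 2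
      ≤ (√(∑' k, f k ^ 2) * √(∑' k, g k ^ 2)) ^ 2 :=
        pow_le_pow_left₀ (tsum_nonneg fun k => mul_nonneg (hf k) (hg k)) h2 2
    _ = _ := by rw [mul_pow, Real.sq_sqrt hF, Real.sq_sqrt hG]

theorem summable_and_tsum_eq_of_swap {κ : Type*} {a b : κ → κ → ℝ} {u v : κ → ℝ}
    (ha : ∀ i j, 0 ≤ a i j) (hab : ∀ i j, a i j = b j i) (hu : ∀ i, HasSum (a i) (u i))
    (hv : ∀ i, HasSum (b i) (v i)) (hs : Summable u) :
    Summable v ∧ ∑' i, v i = ∑' i, u i := by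
  have h1 : Summable (Function.uncurry a) := by
    refine (summable_prod_of_nonneg fun p => ha p.1 p.2).mpr ⟨fun i => (hu i).summable, ?_⟩
    exact hs.congr fun i => (hu i).tsum_eq.symm
  have h2 : Summable (Function.uncurry b) := h1.prod_symm.congr fun p => hab p.2 p.1
  have h3 := h1.hasSum.prod_fiberwise hu
  have h4 := h2.hasSum.prod_fiberwise hv
  refine ⟨h4.summable, ?_⟩
  rw [h3.tsum_eq, h4.tsum_eq, ← (Equiv.prodComm κ κ).tsum_eq]
  exact tsum_congr fun p => (hab p.1 p.2).symm

/-! ### Hilbert-Schmidt and trace class operators. -/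

section Operators

variable {ι H : Type*} [NormedAddCommGroup H] [InnerProductSpace ℂ H]

theorem hasSum_norm_inner_sq (e : HilbertBasis ι ℂ H) (x : H) :
    HasSum (fun i => ‖inner ℂ (e i) x‖ ^ 2) (‖x‖ ^ 2) := by
  have h := (e.hasSum_inner_mul_inner x x).mapL Complex.reCLM
  convert! h using 1
  · ext i
    rw [← inner_conj_symm x (e i), Complex.conj_mul']
    simp [← Complex.ofReal_pow]
  · simp [← Complex.ofReal_pow]

theorem IsHilbertSchmidt.mul_left {e : HilbertBasis ι ℂ H} {A : H →L[ℂ] H}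
    (hA : IsHilbertSchmidt e A) (T : H →L[ℂ] H) :
    IsHilbertSchmidt e (T * A) ∧
      ∑' i, ‖(T * A) (e i)‖ ^ 2 ≤ ‖T‖ ^ 2 * ∑' i, ‖A (e i)‖ ^ 2 := by
  have hle : ∀ i, ‖(T * A) (e i)‖ ^ 2 ≤ ‖T‖ ^ 2 * ‖A (e i)‖ ^ 2 := fun i => by
    rw [← mul_pow]
    exact pow_le_pow_left₀ (norm_nonneg _) (T.le_opNorm _) 2
  have hs : Summable fun i => ‖T‖ ^ 2 * ‖A (e i)‖ ^ 2 := Summable.mul_left _ hA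
  have hs' : IsHilbertSchmidt e (T * A) := hs.of_nonneg_of_le (fun i => sq_nonneg _) hle
  exact ⟨hs', by rw [← tsum_mul_left]; exact hs'.tsum_le_tsum hle hs⟩

variable [CompleteSpace H]

/-- By Parseval, both sums add up the squared matrix entries of A, by columns and by rows (Tonelli).
-/
theorem IsHilbertSchmidt.adjoint_and_tsum {e : HilbertBasis ι ℂ H} {A : H →L[ℂ] H}
    (hA : IsHilbertSchmidt e A) :
    IsHilbertSchmidt e (adjoint A) ∧
      ∑' i, ‖adjoint A (e i)‖ ^ 2 = ∑' i, ‖A (e i)‖ ^ 2 := by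
  have hsymm : ∀ i j, ‖inner ℂ (e j) (A (e i))‖ ^ 2 = ‖inner ℂ (e i) (adjoint A (e j))‖ ^ 2 := by
    intro i j
    rw [← adjoint_inner_left, ← inner_conj_symm, RCLike.norm_conj]
  exact summable_and_tsum_eq_of_swap (fun i j => sq_nonneg _) hsymm
    (fun i => hasSum_norm_inner_sq e (A (e i))) (fun i => hasSum_norm_inner_sq e (adjoint A (e i)))
    hA

/-- The operator norm is at most the Hilbert-Schmidt norm. -/
theorem IsHilbertSchmidt.norm_sq_le {e : HilbertBasis ι ℂ H} {A : H →L[ℂ] H}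
    (hA : IsHilbertSchmidt e A) : ‖A‖ ^ 2 ≤ ∑' i, ‖A (e i)‖ ^ 2 := by
  obtain ⟨hA', hsum⟩ := hA.adjoint_and_tsum
  have hS : 0 ≤ ∑' i, ‖A (e i)‖ ^ 2 := tsum_nonneg fun i => sq_nonneg _
  refine (Real.le_sqrt (norm_nonneg _) hS).mp (opNorm_le_bound _ (Real.sqrt_nonneg _) fun x => ?_)
  refine abs_le_of_sq_le_sq' ?_ (by positivity) |>.2
  rw [mul_pow, Real.sq_sqrt hS, ← (hasSum_norm_inner_sq e (A x)).tsum_eq, ← hsum,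
    ← tsum_mul_right]
  refine (hasSum_norm_inner_sq e (A x)).summable.tsum_le_tsum (fun i => ?_) (hA'.mul_right _)
  rw [← adjoint_inner_left, ← mul_pow]
  exact pow_le_pow_left₀ (norm_nonneg _) (norm_inner_le_norm _ _) 2

/-- A contraction `V` with `V * T` arbitrarily close to the modulus of `T`. -/
theorem exists_norm_le_one_norm_abs_sub_mul_le (T : H →L[ℂ] H) {ε : ℝ} (hε : 0 < ε) :
    ∃ V : H →L[ℂ] H, ‖V‖ ≤ 1 ∧ ‖CFC.abs T - V * T‖ ≤ ε := by
  set P := CFC.abs T with hP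
  have hP0 : 0 ≤ P := CFC.abs_nonneg T
  have hPsa : IsSelfAdjoint P := hP0.isSelfAdjoint
  have hspec : ∀ x ∈ spectrum ℝ P, 0 ≤ x := fun x hx => spectrum_nonneg_of_nonneg hP0 hx
  have hne : ∀ x ∈ spectrum ℝ P, x + ε ≠ 0 := fun x hx => by linarith [hspec x hx]
  have hk : ContinuousOn (fun x : ℝ => (x + ε)⁻¹) (spectrum ℝ P) :=
    ContinuousOn.inv₀ (by fun_prop) hne
  -- K = (P + ε)⁻¹, and V = K T* replaces the adjoint of the polar isometry: VV* = (KP)² gives ‖V‖ ≤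
  -- 1, and P - VT = εP(P + ε)⁻¹.
  set K : H →L[ℂ] H := cfc (fun x : ℝ => (x + ε)⁻¹) P with hK
  have hKsa : star K = K := (cfc_predicate _ P : IsSelfAdjoint K)
  have hPP : P * P = star T * T := CFC.abs_mul_abs T
  have hid : P = cfc (fun x : ℝ => x) P := (cfc_id' ℝ P).symm
  have hKP : K * P = cfc (fun x : ℝ => (x + ε)⁻¹ * x) P := by
    rw [cfc_mul (fun x : ℝ => (x + ε)⁻¹) (fun x => x) P hk (by fun_prop), ← hid]
  have hKPn : ‖K * P‖ ≤ 1 := by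
    rw [hKP]
    refine norm_cfc_le zero_le_one fun x hx => ?_
    have := hspec x hx
    rw [Real.norm_of_nonneg (by positivity), inv_mul_le_iff₀ (by positivity)]
    linarith
  refine ⟨K * star T, ?_, ?_⟩
  · have h1 : ‖K * star T‖ * ‖K * star T‖ = ‖K * P‖ * ‖K * P‖ := by
      rw [← CStarRing.norm_self_mul_star, ← CStarRing.norm_self_mul_star]
      congr 1
      rw [star_mul, star_mul, star_star, hPsa.star_eq, hKsa]
      calc K * star T * (T * K) = K * (star T * T) * K := by simp only [mul_assoc]
        _ = _ := by rw [← hPP]; simp only [mul_assoc]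
    rwa [(mul_self_inj (norm_nonneg _) (norm_nonneg _)).mp h1]
  · have h2 : P - K * star T * T = cfc (fun x : ℝ => x - (x + ε)⁻¹ * x * x) P := by
      rw [mul_assoc, ← hPP, ← mul_assoc, hKP]
      rw [cfc_sub (fun x : ℝ => x) (fun x => (x + ε)⁻¹ * x * x) P (by fun_prop)
        ((hk.mul continuousOn_id).mul continuousOn_id),
        cfc_mul (fun x : ℝ => (x + ε)⁻¹ * x) (fun x => x) P (hk.mul continuousOn_id)
        (by fun_prop), ← hid]
    rw [h2]
    refine norm_cfc_le hε.le fun x hx => ?_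
    have hx0 := hspec x hx
    have hx1 : 0 < x + ε := by linarith
    have : x - (x + ε)⁻¹ * x * x = ε * x / (x + ε) := by field_simp; ring
    rw [this, Real.norm_of_nonneg (by positivity), div_le_iff₀ hx1]
    nlinarith

theorem IsTraceClass.of_nonneg {e : HilbertBasis ι ℂ H} {A : H →L[ℂ] H} (hA : 0 ≤ A)
    (hs : Summable fun i => inner ℂ (e i) (A (e i))) : IsTraceClass e A := by
  rw [IsTraceClass, CFC.abs_of_nonneg A hA]
  exact hs

/-- The product of two Hilbert-Schmidt operators is trace class. -/
theorem IsHilbertSchmidt.isTraceClass_mul {e : HilbertBasis ι ℂ H} {X Y : H →L[ℂ] H}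
    (hX : IsHilbertSchmidt e X) (hY : IsHilbertSchmidt e Y) : IsTraceClass e (X * Y) := by
  set P := CFC.abs (X * Y) with hP
  have hpos : P.IsPositive := (nonneg_iff_isPositive _).mp (CFC.abs_nonneg _)
  have hreal : ∀ i, inner ℂ (e i) (P (e i)) = ((inner ℂ (e i) (P (e i))).re : ℂ) := fun i =>
    Complex.ext rfl (Complex.le_def.mp (hpos.inner_nonneg_right (e i))).2.symm
  have hre : ∀ i, 0 ≤ (inner ℂ (e i) (P (e i))).re := fun i => hpos.re_inner_nonneg_right (e i)
  rw [IsTraceClass, ← hP]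
  refine (Complex.summable_ofReal.mpr ?_).congr fun i => (hreal i).symm
  -- V below depends on s and δ, but this bound does not: ‖V‖ ≤ 1 keeps the Hilbert-Schmidt norm of
  -- VX below that of X.
  refine summable_of_sum_le (c := √((∑' i, ‖X (e i)‖ ^ 2) * ∑' i, ‖Y (e i)‖ ^ 2)) hre fun s => ?_
  refine le_of_forall_pos_le_add fun δ hδ => ?_
  obtain ⟨V, hV, hVP⟩ := exists_norm_le_one_norm_abs_sub_mul_le (X * Y)
    (ε := δ / (s.card + 1)) (div_pos hδ s.card.cast_add_one_pos)
  obtain ⟨hVX, hVXle⟩ := hX.mul_left V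
  obtain ⟨hZ, hZsum⟩ := hVX.adjoint_and_tsum
  have hterm : ∀ i ∈ s, (inner ℂ (e i) (P (e i))).re ≤
      ‖adjoint (V * X) (e i)‖ * ‖Y (e i)‖ + δ / (s.card + 1) := by
    intro i _
    have h1 : P (e i) = (V * X) (Y (e i)) + (P - V * (X * Y)) (e i) := by
      rw [sub_apply]
      exact (add_sub_cancel _ _).symm
    rw [h1, inner_add_right, Complex.add_re, ← adjoint_inner_left]
    refine add_le_add ((Complex.re_le_norm _).trans (norm_inner_le_norm _ _))
      ((Complex.re_le_norm _).trans ((norm_inner_le_norm _ _).trans ?_))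
    rw [e.orthonormal.norm_eq_one, one_mul]
    refine (le_opNorm _ _).trans ?_
    rwa [e.orthonormal.norm_eq_one, mul_one]
  obtain ⟨hsm, hcs⟩ := summable_mul_and_tsum_mul_sq_le (fun i => norm_nonneg _)
    (fun i => norm_nonneg _) hZ hY
  refine (Finset.sum_le_sum hterm).trans ?_
  rw [Finset.sum_add_distrib, Finset.sum_const, nsmul_eq_mul]
  refine add_le_add ?_ ?_
  · refine (hsm.sum_le_tsum s fun i _ => by positivity).trans (Real.le_sqrt_of_sq_le ?_)
    refine hcs.trans ?_
    rw [hZsum]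
    refine mul_le_mul_of_nonneg_right (hVXle.trans ?_) (tsum_nonneg fun i => sq_nonneg _)
    refine mul_le_of_le_one_left (tsum_nonneg fun i => sq_nonneg _) ?_
    exact pow_le_one₀ (norm_nonneg _) hV
  · rw [mul_div_assoc', div_le_iff₀ s.card.cast_add_one_pos]
    nlinarith

end Operators

/-! ### Power series of operators and their traces. -/

theorem exists_le_and_summable_norm_mul_pow {α : ℕ → ℂ} {R : ENNReal}
    (hconv : ∀ z : ℂ, ENNReal.ofReal ‖z‖ < R →
      ∃ s : ℂ, Filter.Tendsto (fun N => ∑ n ∈ Finset.range N, α n * z ^ n) Filter.atTop (nhds s))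
    {t : ℝ} (ht : ENNReal.ofReal t < R) :
    ∃ r : ℝ, t ≤ r ∧ 0 < r ∧ Summable fun n => ‖α n‖ * r ^ n := by
  obtain ⟨r, htr, hrR⟩ := ENNReal.lt_iff_exists_nnreal_btwn.mp ht
  obtain ⟨q, hrq, hqR⟩ := ENNReal.lt_iff_exists_nnreal_btwn.mp hrR
  have hr0 : 0 < r := ENNReal.coe_pos.mp (bot_le.trans_lt htr)
  have hrq' : r < q := ENNReal.coe_lt_coe.mp hrq
  have hq0 : 0 < q := hr0.trans hrq'
  refine ⟨r, ?_, hr0, ?_⟩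
  · rw [ENNReal.ofReal, ENNReal.coe_lt_coe] at htr
    exact (Real.le_coe_toNNReal t).trans (NNReal.coe_le_coe.mpr htr.le)
  obtain ⟨s, hs⟩ := hconv ((q : ℝ) : ℂ) (by simpa using hqR)
  -- Convergence at q > r bounds the terms there, so at r they are dominated by a geometric series.
  have hterm : Filter.Tendsto (fun n => α n * ((q : ℝ) : ℂ) ^ n) Filter.atTop (nhds 0) := by
    have h := ((Filter.tendsto_add_atTop_iff_nat 1).mpr hs).sub hs
    simpa [Finset.sum_range_succ] using h
  obtain ⟨C, hC⟩ := hterm.norm.bddAbove_range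
  have hgeo : Summable fun n : ℕ => C * ((r : ℝ) / q) ^ n := by
    refine (summable_geometric_of_lt_one (by positivity) ?_).mul_left C
    rw [div_lt_one (by exact_mod_cast hq0)]
    exact_mod_cast hrq'
  refine hgeo.of_nonneg_of_le (fun n => by positivity) fun n => ?_
  have h1 : ‖α n‖ * (q : ℝ) ^ n ≤ C := by
    have := hC (Set.mem_range_self n)
    simpa using this
  have hq : (q : ℝ) ≠ 0 := by exact_mod_cast hq0.ne'
  calc ‖α n‖ * (r : ℝ) ^ n = ‖α n‖ * (q : ℝ) ^ n * ((r : ℝ) / q) ^ n := by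
        rw [div_pow]; field_simp
    _ ≤ _ := mul_le_mul_of_nonneg_right h1 (by positivity)

variable {ι H : Type*} [NormedAddCommGroup H] [InnerProductSpace ℂ H]

/-- Stated pointwise to include n = 0 on the zero space, where ‖1‖ = 0. -/
theorem norm_pow_apply_le (T : H →L[ℂ] H) (n : ℕ) (x : H) : ‖(T ^ n) x‖ ≤ ‖T‖ ^ n * ‖x‖ := by
  induction n with
  | zero => simp
  | succ n ih =>
    rw [pow_succ', pow_succ', mul_assoc]
    exact (T.le_opNorm _).trans (mul_le_mul_of_nonneg_left ih (norm_nonneg _))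

/-- `‖a n‖ ‖A ^ n (e i)‖ ^ 2` is summable over all `i` and `n`. -/
theorem IsHilbertSchmidt.summable_mul_norm_pow_sq {e : HilbertBasis ι ℂ H} {A : H →L[ℂ] H}
    (hA : IsHilbertSchmidt e A) {a : ℕ → ℂ} {r : ℝ} (hr : 0 < r) (hAr : ‖A‖ ^ 2 ≤ r)
    (ha : Summable fun n => ‖a n‖ * r ^ n) (h0 : Finite ι ∨ a 0 = 0) :
    Summable fun p : ι × ℕ => ‖a p.2‖ * ‖(A ^ p.2) (e p.1)‖ ^ 2 := by
  rcases h0 with h0 | h0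
  · have h1 : Summable fun _ : ι => (1 : ℝ) := Summable.of_finite
    refine (h1.mul_of_nonneg ha (fun _ => zero_le_one) fun n => by positivity).of_nonneg_of_le
      (fun p => by positivity) fun p => ?_
    rw [one_mul]
    refine mul_le_mul_of_nonneg_left ?_ (norm_nonneg _)
    have h2 := norm_pow_apply_le A p.2 (e p.1)
    rw [e.orthonormal.norm_eq_one, mul_one] at h2
    calc ‖(A ^ p.2) (e p.1)‖ ^ 2 ≤ (‖A‖ ^ p.2) ^ 2 := pow_le_pow_left₀ (norm_nonneg _) h2 2
      _ = (‖A‖ ^ 2) ^ p.2 := by rw [← pow_mul, ← pow_mul, mul_comm]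
      _ ≤ r ^ p.2 := pow_le_pow_left₀ (sq_nonneg _) hAr _
  -- One factor A is kept for the sum over i; dividing by r makes up for the lost power.
  · have h1 : Summable fun i => ‖A (e i)‖ ^ 2 / r := Summable.div_const hA r
    refine (h1.mul_of_nonneg ha (fun _ => by positivity) fun n => by positivity).of_nonneg_of_le
      (fun p => by positivity) ?_
    rintro ⟨i, n⟩
    cases n with
    | zero => simp [h0]
    | succ n =>
      have h2 := norm_pow_apply_le A n (A (e i))
      have h3 : ‖(A ^ (n + 1)) (e i)‖ ^ 2 ≤ r ^ n * ‖A (e i)‖ ^ 2 := by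
        calc ‖(A ^ (n + 1)) (e i)‖ ^ 2 = ‖(A ^ n) (A (e i))‖ ^ 2 := by rw [pow_succ]; rfl
          _ ≤ (‖A‖ ^ n * ‖A (e i)‖) ^ 2 := pow_le_pow_left₀ (norm_nonneg _) h2 2
          _ = (‖A‖ ^ 2) ^ n * ‖A (e i)‖ ^ 2 := by
            rw [mul_pow, ← pow_mul, ← pow_mul, mul_comm n 2]
          _ ≤ _ := mul_le_mul_of_nonneg_right (pow_le_pow_left₀ (sq_nonneg _) hAr _)
            (sq_nonneg _)
      calc ‖a (n + 1)‖ * ‖(A ^ (n + 1)) (e i)‖ ^ 2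
          ≤ ‖a (n + 1)‖ * (r ^ n * ‖A (e i)‖ ^ 2) :=
            mul_le_mul_of_nonneg_left h3 (norm_nonneg _)
        _ = ‖A (e i)‖ ^ 2 / r * (‖a (n + 1)‖ * r ^ (n + 1)) := by
          rw [pow_succ r]; field_simp

theorem hasSum_inner_opSeries {a : ℕ → ℂ} {T : H →L[ℂ] H} (hs : Summable fun n => a n • T ^ n)
    (x y : H) : HasSum (fun n => a n * inner ℂ x ((T ^ n) y)) (inner ℂ x (opSeries a T y)) := by
  have h := (hs.hasSum.mapL (ContinuousLinearMap.apply ℂ H y)).mapL (innerSL ℂ x)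
  simpa [inner_smul_right, opSeries] using h

variable [CompleteSpace H]

theorem summable_smul_pow {a : ℕ → ℂ} {r : ℝ} {T : H →L[ℂ] H} (hT : ‖T‖ ≤ r)
    (ha : Summable fun n => ‖a n‖ * r ^ n) : Summable fun n => a n • T ^ n := by
  refine Summable.of_norm_bounded ha fun n => ?_
  rw [norm_smul]
  refine mul_le_mul_of_nonneg_left ?_ (norm_nonneg _)
  exact (opNorm_le_bound _ (by positivity) (norm_pow_apply_le T n)).trans
    (pow_le_pow_left₀ (norm_nonneg _) hT n)

theorem inner_adjoint_mul_pow {A B : H →L[ℂ] H} (hAB : Commute (adjoint A) B) (n : ℕ) (x y : H) :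
    inner ℂ x (((adjoint A * B) ^ n) y) = inner ℂ ((A ^ n) x) ((B ^ n) y) := by
  rw [hAB.mul_pow, ← star_eq_adjoint, ← star_pow, star_eq_adjoint, mul_apply_eq_comp,
    adjoint_inner_right]

/-- The trace of a power series of `A* B` as an absolutely convergent double series. -/
theorem summable_inner_opSeries_and_trace_eq {e : HilbertBasis ι ℂ H} {a : ℕ → ℂ}
    {A B : H →L[ℂ] H} (hAB : Commute (adjoint A) B)
    (hs : Summable fun n => a n • (adjoint A * B) ^ n)
    (hsum : Summable fun p : ι × ℕ => a p.2 * inner ℂ ((A ^ p.2) (e p.1)) ((B ^ p.2) (e p.1))) :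
    (Summable fun i => inner ℂ (e i) (opSeries a (adjoint A * B) (e i))) ∧
      trace e (opSeries a (adjoint A * B)) =
        ∑' p : ι × ℕ, a p.2 * inner ℂ ((A ^ p.2) (e p.1)) ((B ^ p.2) (e p.1)) := by
  have h : ∀ i, HasSum (fun n => a n * inner ℂ ((A ^ n) (e i)) ((B ^ n) (e i)))
      (inner ℂ (e i) (opSeries a (adjoint A * B) (e i))) := fun i => by
    simpa only [inner_adjoint_mul_pow hAB] using hasSum_inner_opSeries hs (e i) (e i)
  have h2 := hsum.hasSum.prod_fiberwise h
  exact ⟨h2.summable, h2.tsum_eq⟩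

/-- The case `A = B` with nonnegative coefficients. -/
theorem isTraceClass_opSeries_norm_and_trace_eq {e : HilbertBasis ι ℂ H} {a : ℕ → ℂ}
    {A : H →L[ℂ] H} (hA : Commute (adjoint A) A)
    (hs : Summable fun n => (‖a n‖ : ℂ) • (adjoint A * A) ^ n)
    (hsum : Summable fun p : ι × ℕ => ‖a p.2‖ * ‖(A ^ p.2) (e p.1)‖ ^ 2) :
    IsTraceClass e (opSeries (fun n => (‖a n‖ : ℂ)) (adjoint A * A)) ∧
      trace e (opSeries (fun n => (‖a n‖ : ℂ)) (adjoint A * A)) =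
        ((∑' p : ι × ℕ, ‖a p.2‖ * ‖(A ^ p.2) (e p.1)‖ ^ 2 : ℝ) : ℂ) := by
  have hterm : ∀ p : ι × ℕ,
      (‖a p.2‖ : ℂ) * inner ℂ ((A ^ p.2) (e p.1)) ((A ^ p.2) (e p.1)) =
        ((‖a p.2‖ * ‖(A ^ p.2) (e p.1)‖ ^ 2 : ℝ) : ℂ) := fun p => by
    rw [inner_self_eq_norm_sq_to_K]
    push_cast
    rfl
  obtain ⟨h1, h2⟩ := summable_inner_opSeries_and_trace_eq (e := e) hA hs
    ((Complex.summable_ofReal.mpr hsum).congr fun p => (hterm p).symm)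
  refine ⟨IsTraceClass.of_nonneg ?_ h1, ?_⟩
  -- Each term is positive, its quadratic form being |a_n| ‖A^n x‖².
  · refine tsum_nonneg fun n => (nonneg_iff_isPositive _).mpr ?_
    refine (isPositive_iff_complex _).mpr fun x => ?_
    have h3 : inner ℂ ((((‖a n‖ : ℂ) • (adjoint A * A) ^ n) : H →L[ℂ] H) x) x =
        ((‖a n‖ * ‖(A ^ n) x‖ ^ 2 : ℝ) : ℂ) := by
      rw [← inner_conj_symm, smul_apply, inner_smul_right, inner_adjoint_mul_pow hA,
        inner_self_eq_norm_sq_to_K]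
      simp
    rw [h3]
    exact ⟨congrArg _ (Complex.ofReal_re _), (mul_nonneg (norm_nonneg (a n)) (sq_nonneg ‖(A ^ n) x‖)).trans_eq
      (Complex.ofReal_re _).symm⟩
  · rw [h2, Complex.ofReal_tsum]
    exact tsum_congr hterm

/-- Without constant term, a power series of `A* B` is trace class for `A`, `B` Hilbert-Schmidt. -/
theorem isTraceClass_opSeries {e : HilbertBasis ι ℂ H} {A B : H →L[ℂ] H}
    (hA : IsHilbertSchmidt e A) (hB : IsHilbertSchmidt e B) {a : ℕ → ℂ} {r : ℝ} (hr : 0 < r)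
    (hABr : ‖adjoint A * B‖ ≤ r) (ha : Summable fun n => ‖a n‖ * r ^ n) (h0 : a 0 = 0) :
    IsTraceClass e (opSeries a (adjoint A * B)) := by
  set T := adjoint A * B with hT
  have ha' : Summable fun n => ‖a (n + 1)‖ * r ^ n :=
    (((summable_nat_add_iff 1).mpr ha).div_const r).congr fun n => by
      rw [pow_succ]; field_simp
  have hs' := summable_smul_pow hABr ha'
  -- With g the shifted series, f(T) = (g(T) A*) B, and g(T) A* is Hilbert-Schmidt.
  have heq : opSeries a T = opSeries (fun n => a (n + 1)) T * adjoint A * B := by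
    rw [mul_assoc, ← hT, opSeries, opSeries, (summable_smul_pow hABr ha).tsum_eq_zero_add, h0,
      zero_smul, zero_add, ← hs'.tsum_mul_right]
    exact tsum_congr fun n => by rw [pow_succ, smul_mul_assoc]
  rw [heq]
  exact (hA.adjoint_and_tsum.1.mul_left _).1.isTraceClass_mul hB

end HilbertTrace

theorem theorem2p4 {ι H : Type*} [NormedAddCommGroup H] [InnerProductSpace ℂ H] [CompleteSpace H]
    (e : HilbertBasis ι ℂ H)
    (α : ℕ → ℂ) (R : ENNReal) (hR : 0 < R)
    (hconv : ∀ z : ℂ, ENNReal.ofReal ‖z‖ < R →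
      ∃ s : ℂ, Filter.Tendsto (fun N => ∑ n ∈ Finset.range N, α n * z ^ n) Filter.atTop (nhds s))
    (hα : FiniteDimensional ℂ H ∨ α 0 = 0)
    (A B : H →L[ℂ] H)
    (hA : HilbertTrace.IsHilbertSchmidt e A) (hB : HilbertTrace.IsHilbertSchmidt e B)
    (hAn : IsStarNormal A) (hBn : IsStarNormal B)
    (hAB : ContinuousLinearMap.adjoint A * B = B * ContinuousLinearMap.adjoint A)
    (htA : ENNReal.ofReal (HilbertTrace.trace e (CFC.abs A ^ 2)).re < R)
    (htB : ENNReal.ofReal (HilbertTrace.trace e (CFC.abs B ^ 2)).re < R) :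
    -- the three operator power series converge
    Summable (fun n => α n • (ContinuousLinearMap.adjoint A * B) ^ n) ∧
    Summable (fun n => (‖α n‖ : ℂ) • (CFC.abs A ^ 2) ^ n) ∧
    Summable (fun n => (‖α n‖ : ℂ) • (CFC.abs B ^ 2) ^ n) ∧
    -- their sums are trace class operators
    HilbertTrace.IsTraceClass e
      (HilbertTrace.opSeries α (ContinuousLinearMap.adjoint A * B)) ∧
    HilbertTrace.IsTraceClass e
      (HilbertTrace.opSeries (fun n => (‖α n‖ : ℂ)) (CFC.abs A ^ 2)) ∧
    HilbertTrace.IsTraceClass e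
      (HilbertTrace.opSeries (fun n => (‖α n‖ : ℂ)) (CFC.abs B ^ 2)) ∧
    -- the inequality; `≤` on `ℂ` also says that the right-hand side is real
    ((‖HilbertTrace.trace e
        (HilbertTrace.opSeries α (ContinuousLinearMap.adjoint A * B))‖ ^ 2 : ℝ) : ℂ) ≤
      HilbertTrace.trace e (HilbertTrace.opSeries (fun n => (‖α n‖ : ℂ)) (CFC.abs A ^ 2)) *
      HilbertTrace.trace e (HilbertTrace.opSeries (fun n => (‖α n‖ : ℂ)) (CFC.abs B ^ 2)) := by
  have hι : Finite ι ∨ α 0 = 0 := hα.imp_left fun _ : FiniteDimensional ℂ H => e.orthonormal.linearIndependent.finite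
  have hcA : Commute (adjoint A) A := hAn.star_comm_self
  have hcB : Commute (adjoint B) B := hBn.star_comm_self
  have habs : ∀ T : H →L[ℂ] H, CFC.abs T ^ 2 = adjoint T * T := CFC.abs_sq
  have htr : ∀ T : H →L[ℂ] H,
      (HilbertTrace.trace e (CFC.abs T ^ 2)).re = ∑' i, ‖T (e i)‖ ^ 2 := fun T => by
    have h : HilbertTrace.trace e (CFC.abs T ^ 2) = ((∑' i, ‖T (e i)‖ ^ 2 : ℝ) : ℂ) := by
      rw [Complex.ofReal_tsum]
      refine tsum_congr fun i => ?_
      rw [habs, mul_apply_eq_comp, adjoint_inner_right, inner_self_eq_norm_sq_to_K]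
      norm_cast
    rw [h, Complex.ofReal_re]
  rw [htr] at htA htB
  obtain ⟨r, hr, hr0, hsr⟩ := HilbertTrace.exists_le_and_summable_norm_mul_pow hconv
    (t := max (∑' i, ‖A (e i)‖ ^ 2) (∑' i, ‖B (e i)‖ ^ 2)) (by
      rcases max_choice (∑' i, ‖A (e i)‖ ^ 2) (∑' i, ‖B (e i)‖ ^ 2) with h | h <;> rwa [h])
  have hAr : ‖A‖ ^ 2 ≤ r := hA.norm_sq_le.trans ((le_max_left _ _).trans hr)
  have hBr : ‖B‖ ^ 2 ≤ r := hB.norm_sq_le.trans ((le_max_right _ _).trans hr)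
  have hnorm : ∀ S T : H →L[ℂ] H, ‖S‖ ^ 2 ≤ r → ‖T‖ ^ 2 ≤ r → ‖adjoint S * T‖ ≤ r := by
    intro S T hS hT
    have h : ‖adjoint S * T‖ ≤ ‖S‖ * ‖T‖ := by
      rw [← LinearIsometryEquiv.norm_map adjoint S]
      exact norm_mul_le _ _
    -- ‖S‖‖T‖ ≤ (‖S‖² + ‖T‖²)/2 ≤ r.
    nlinarith [sq_nonneg (‖S‖ - ‖T‖)]
  have hsr' : Summable fun n => ‖(‖α n‖ : ℂ)‖ * r ^ n := by simpa using hsr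
  have hsAB := HilbertTrace.summable_smul_pow (hnorm A B hAr hBr) hsr
  have hsA := HilbertTrace.summable_smul_pow (hnorm A A hAr hAr) hsr'
  have hsB := HilbertTrace.summable_smul_pow (hnorm B B hBr hBr) hsr'
  have hwA := hA.summable_mul_norm_pow_sq hr0 hAr hsr hι
  have hwB := hB.summable_mul_norm_pow_sq hr0 hBr hsr hι
  obtain ⟨htcA, htrA⟩ := HilbertTrace.isTraceClass_opSeries_norm_and_trace_eq hcA hsA hwA
  obtain ⟨htcB, htrB⟩ := HilbertTrace.isTraceClass_opSeries_norm_and_trace_eq hcB hsB hwB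
  simp only [habs]
  refine ⟨hsAB, hsA, hsB, ?_, htcA, htcB, ?_⟩
  · rcases hι with _ | h0
    · exact Summable.of_finite
    · exact HilbertTrace.isTraceClass_opSeries hA hB hr0 (hnorm A B hAr hBr) hsr h0
  · have hsq : ∀ (T : H →L[ℂ] H) (p : ι × ℕ), (√‖α p.2‖ * ‖(T ^ p.2) (e p.1)‖) ^ 2 =
        ‖α p.2‖ * ‖(T ^ p.2) (e p.1)‖ ^ 2 := fun T p => by
      rw [mul_pow, Real.sq_sqrt (norm_nonneg _)]
    -- Each factor takes √|α_n|; the product also majorizes the series for tr f(A*B).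
    obtain ⟨hm, hcs⟩ := HilbertTrace.summable_mul_and_tsum_mul_sq_le
      (f := fun p : ι × ℕ => √‖α p.2‖ * ‖(A ^ p.2) (e p.1)‖)
      (g := fun p : ι × ℕ => √‖α p.2‖ * ‖(B ^ p.2) (e p.1)‖)
      (fun p => by positivity) (fun p => by positivity)
      (by simpa only [hsq] using hwA) (by simpa only [hsq] using hwB)
    simp only [hsq] at hcs
    have hbound : ∀ p : ι × ℕ,
        ‖α p.2 * inner ℂ ((A ^ p.2) (e p.1)) ((B ^ p.2) (e p.1))‖ ≤
          √‖α p.2‖ * ‖(A ^ p.2) (e p.1)‖ * (√‖α p.2‖ * ‖(B ^ p.2) (e p.1)‖) := fun p => by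
      rw [norm_mul, mul_mul_mul_comm, Real.mul_self_sqrt (norm_nonneg _)]
      exact mul_le_mul_of_nonneg_left (norm_inner_le_norm _ _) (norm_nonneg _)
    have htrAB := (HilbertTrace.summable_inner_opSeries_and_trace_eq (e := e) hAB hsAB
      (Summable.of_norm_bounded hm hbound)).2
    rw [htrA, htrB, ← Complex.ofReal_mul, Complex.real_le_real, htrAB]
    exact (pow_le_pow_left₀ (norm_nonneg _) (tsum_of_norm_bounded hm.hasSum hbound) 2).trans hcs
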